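/- Let $\ell$ be a commutative unital ring with involution. All $*$-algebras are over $\ell$, with semilinear involution, and $*$-homomorphisms need not be unital. A projection in a $*$-algebra $A$ is a self-adjoint idempotent. Two projections $p,q$ are equivalent, $p\sim q$, if $p=x^*x$ and $q=xx^*$ for some $x\in A$. Let $\mathcal V_\infty(A)^*$ be the abelian monoid, under orthogonal sum, of equivalence classes of projections in $M_\infty(A)=\bigcup_n M_n(A)$ (conjugate transpose involution), and let $K_0(A)^*$ be its group completion, where $A$ is either unital or a Leavitt path algebra. Let $E=(s,r:E^1\rightrightarrows E^0)$ be a directed graph. A vertex $v$ is singular if $s^{-1}(v)$ is empty or infinite, and regular otherwise. Let $A_E$ be the $\operatorname{reg}(E)\times E^0$-matrix with $(A_E)_{v,w}=|s^{-1}(v)\cap r^{-1}(w)|$, and let $$\mathfrak{BF}(E)=\operatorname{Coker}\big(I-A_E^t:\mathbb Z^{(\operatorname{reg}(E))}\to\mathbb Z^{(E^0)}\big).$$ Let $L(E)$ be the Leavitt path algebra of $E$ over $\ell$ with its standard involution, which fixes the vertices and maps each edge $e$ to the phantom edge $e^*$, and let $\operatorname{can}':\mathfrak{BF}(E)\to K_0(L(E))^*$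 be the group homomorphism with $\operatorname{can}'([v])=[v]$ for $v\in E^0$. Let $R$ be a unital $*$-algebra which is strictly properly infinite, that is, there are $s_1,s_2\in R$ with $s_i^*s_j=\delta_{i,j}$. A projection $p\in R$ is very full if there is a projection $q\in R$ with $q=pq=qp$ and $q\sim 1$. A $*$-homomorphism $\phi:L(E)\to R$ is very full if $\phi(ee^*)$ is a very full projection for every $e\in E^1$ and $\phi(v)$ is a very full projection for every singular vertex $v$. Theorem. Let $E$ be a countable graph ($E^0$ and $E^1$ countable), $R$ a unital strictly properly infinite $*$-algebra, and $\xi:\mathfrak{BF}(E)\to K_0(R)^*$ a group homomorphism. Then there is a very full $*$-homomorphism $\phi:L(E)\to R$ such that $K_0(\phi)^*\circ\operatorname{can}'=\xi$. If furthermore $E^0$ is finite and nonempty and $p\in R$ is a very full projection such that $\xi\big(\sum_{v\in E^0}[v]\big)=[p]$, then $\phi$ can be chosen so that in addition $\phi(1)=p$. -/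

import Mathlib

open scoped Matrix

noncomputable section

universe u v w x

/-! ### Directed graphs -/

/-- A directed graph with vertex set `V` and edge set `E` (loops and multiple edges allowed),
given by its source and range maps. -/
structure DirGraph (V : Type u) (E : Type v) where
  s : E → V
  r : E → V

namespace DirGraph

variable {V : Type u} {E : Type v} (G : DirGraph V E)

/-- The set of edges emitted by a vertex. -/
def emitted (a : V) : Set E := {e | G.s e = a}

def IsSink (a : V) : Prop := G.emitted a = ∅

def IsInfiniteEmitter (a : V) : Prop := (G.emitted a).Infinite

/-- A vertex is singular if it is a sink or an infinite emitter. -/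
def IsSingular (a : V) : Prop := G.IsSink a ∨ G.IsInfiniteEmitter a

/-- A vertex is regular if it is not singular. -/
def IsRegular (a : V) : Prop := ¬ G.IsSingular a

theorem IsRegular.finite {G : DirGraph V E} {a : V} (h : G.IsRegular a) :
    (G.emitted a).Finite :=
  Set.not_infinite.1 fun h' => h (Or.inr h')

theorem IsRegular.nonempty {G : DirGraph V E} {a : V} (h : G.IsRegular a) :
    (G.emitted a).Nonempty :=
  Set.nonempty_iff_ne_empty.2 fun h' => h (Or.inl h')

/-- The number of edges from `a` to `b`, for `a` regular: the entry `(a, b)` of the reduced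
incidence matrix, whose rows are indexed by the regular vertices. -/
def incidence (a : {a : V // G.IsRegular a}) (b : V) : ℕ :=
  {e : E | G.s e = a ∧ G.r e = b}.ncard

theorem incidence_support (a : {a : V // G.IsRegular a}) :
    (Function.support fun b => (G.incidence a b : ℤ)).Finite := by
  refine (a.2.finite.image G.r).subset fun b hb => ?_
  have h : {e : E | G.s e = a ∧ G.r e = b}.ncard ≠ 0 := by
    simpa [incidence] using hb
  obtain ⟨e, he⟩ := Set.nonempty_of_ncard_ne_zero h
  exact ⟨e, he.1, he.2⟩

/-- The matrix `I - Aᵗ`, with rows indexed by all vertices and columns indexed by the regular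
ones, as a homomorphism `ℤ^(reg) → ℤ^(V)`. -/
def oneSubIncidenceTranspose : ({a : V // G.IsRegular a} →₀ ℤ) →ₗ[ℤ] (V →₀ ℤ) :=
  Finsupp.linearCombination ℤ fun a : {a : V // G.IsRegular a} =>
    Finsupp.single (a : V) (1 : ℤ) -
      Finsupp.ofSupportFinite (fun b => (G.incidence a b : ℤ)) (G.incidence_support a)

/-- The Bowen-Franks group, the cokernel of `I - Aᵗ`. -/
abbrev BowenFranks : Type u :=
  (V →₀ ℤ) ⧸ LinearMap.range G.oneSubIncidenceTranspose

/-- The class of a vertex in the Bowen-Franks group. -/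
def bfClass (a : V) : G.BowenFranks :=
  Submodule.Quotient.mk (Finsupp.single a 1)

/-- The sum of the classes of all vertices. -/
def bfOne [Fintype V] : G.BowenFranks := ∑ a, G.bfClass a

theorem incidence_column (a : {a : V // G.IsRegular a}) :
    Finsupp.ofSupportFinite (fun b => (G.incidence a b : ℤ)) (G.incidence_support a) =
      ∑ e ∈ a.2.finite.toFinset, Finsupp.single (G.r e) (1 : ℤ) := by
  classical
  ext b
  rw [Finsupp.ofSupportFinite_coe, Finsupp.finsetSum_apply]
  simp only [Finsupp.single_apply, Finset.sum_boole]
  congr 1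
  rw [incidence, ← Set.ncard_coe_finset]
  congr 1
  ext e
  simp [emitted]

end DirGraph

/-! ### The Leavitt path algebra -/

/-- Formal expressions in the vertices, the edges and the phantom edges of a graph. -/
inductive LeavittPre (ℓ : Type w) (V : Type u) (E : Type v) : Type (max u v w)
  | vertex (a : V)
  | edge (e : E)
  | ghost (e : E)
  | zero
  | add (f g : LeavittPre ℓ V E)
  | neg (f : LeavittPre ℓ V E)
  | mul (f g : LeavittPre ℓ V E)
  | smul (c : ℓ) (f : LeavittPre ℓ V E)

namespace LeavittPre

variable {ℓ : Type w} {V : Type u} {E : Type v}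

/-- The formal sum of `e e*` over a list of edges. -/
def sumRangeProj (l : List E) : LeavittPre ℓ V E :=
  l.foldr (fun e f => add (mul (edge e) (ghost e)) f) zero

/-- The relations defining the Leavitt path algebra as a (not necessarily unital) associative
`ℓ`-algebra: first compatibility with the operations, then the axioms of an algebra, then the
relations attached to the graph. -/
inductive Rel [CommRing ℓ] (G : DirGraph V E) : LeavittPre ℓ V E → LeavittPre ℓ V E → Prop
  | symm {f g} : Rel G f g → Rel G g f
  | add_left {f f'} (g) : Rel G f f' → Rel G (add f g) (add f' g)
  | add_right (f) {g g'} : Rel G g g' → Rel G (add f g) (add f g')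
  | neg {f f'} : Rel G f f' → Rel G (neg f) (neg f')
  | mul_left {f f'} (g) : Rel G f f' → Rel G (mul f g) (mul f' g)
  | mul_right (f) {g g'} : Rel G g g' → Rel G (mul f g) (mul f g')
  | smul (c) {f f'} : Rel G f f' → Rel G (smul c f) (smul c f')
  | add_assoc (f g h) : Rel G (add (add f g) h) (add f (add g h))
  | add_comm (f g) : Rel G (add f g) (add g f)
  | zero_add (f) : Rel G (add zero f) f
  | neg_add (f) : Rel G (add (LeavittPre.neg f) f) zero
  | mul_assoc (f g h) : Rel G (mul (mul f g) h) (mul f (mul g h))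
  | mul_add (f g h) : Rel G (mul f (add g h)) (add (mul f g) (mul f h))
  | add_mul (f g h) : Rel G (mul (add f g) h) (add (mul f h) (mul g h))
  | smul_add (c f g) : Rel G (LeavittPre.smul c (add f g))
      (add (LeavittPre.smul c f) (LeavittPre.smul c g))
  | add_smul (c d f) : Rel G (LeavittPre.smul (c + d) f)
      (add (LeavittPre.smul c f) (LeavittPre.smul d f))
  | mul_smul (c d f) : Rel G (LeavittPre.smul (c * d) f)
      (LeavittPre.smul c (LeavittPre.smul d f))
  | one_smul (f) : Rel G (LeavittPre.smul 1 f) f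
  | smul_mul (c f g) : Rel G (mul (LeavittPre.smul c f) g) (LeavittPre.smul c (mul f g))
  | mul_smul_comm (c f g) : Rel G (mul f (LeavittPre.smul c g)) (LeavittPre.smul c (mul f g))
  | vertex_mul_self (a) : Rel G (mul (vertex a) (vertex a)) (vertex a)
  | vertex_mul_ne (a b) : a ≠ b → Rel G (mul (vertex a) (vertex b)) zero
  | source_mul_edge (e) : Rel G (mul (vertex (G.s e)) (edge e)) (edge e)
  | edge_mul_range (e) : Rel G (mul (edge e) (vertex (G.r e))) (edge e)
  | range_mul_ghost (e) : Rel G (mul (vertex (G.r e)) (ghost e)) (ghost e)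
  | ghost_mul_source (e) : Rel G (mul (ghost e) (vertex (G.s e))) (ghost e)
  | ghost_mul_self (e) : Rel G (mul (ghost e) (edge e)) (vertex (G.r e))
  | ghost_mul_ne (e f) : e ≠ f → Rel G (mul (ghost e) (edge f)) zero
  | vertex_eq_sum (a) (l : List E) : G.IsRegular a → l.Nodup → (∀ e, e ∈ l ↔ G.s e = a) →
      Rel G (vertex a) (sumRangeProj l)

/-- The standard semilinear involution on formal expressions. -/
def adj [Star ℓ] : LeavittPre ℓ V E → LeavittPre ℓ V E
  | vertex a => vertex a
  | edge e => ghost e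
  | ghost e => edge e
  | zero => zero
  | add f g => add (adj f) (adj g)
  | neg f => neg (adj f)
  | mul f g => mul (adj g) (adj f)
  | smul c f => smul (star c) (adj f)

theorem adj_sumRangeProj [Star ℓ] (l : List E) :
    adj (sumRangeProj l : LeavittPre ℓ V E) = sumRangeProj l := by
  induction l with
  | nil => rfl
  | cons e l ih => simp only [sumRangeProj, List.foldr_cons, adj] at ih ⊢; rw [ih]

theorem adj_adj [InvolutiveStar ℓ] (f : LeavittPre ℓ V E) : adj (adj f) = f := by
  induction f <;> simp_all [adj]

theorem Rel.adj [CommRing ℓ] [StarRing ℓ] {G : DirGraph V E} {f g : LeavittPre ℓ V E}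
    (h : Rel G f g) : Rel G f.adj g.adj := by
  induction h with
  | symm _ ih => exact .symm ih
  | add_left g _ ih => exact .add_left _ ih
  | add_right f _ ih => exact .add_right _ ih
  | neg _ ih => exact .neg ih
  | mul_left g _ ih => exact .mul_right _ ih
  | mul_right f _ ih => exact .mul_left _ ih
  | smul c _ ih => exact .smul _ ih
  | add_assoc f g h => exact .add_assoc _ _ _
  | add_comm f g => exact .add_comm _ _
  | zero_add f => exact .zero_add _
  | neg_add f => exact .neg_add _
  | mul_assoc f g h => exact .symm (.mul_assoc _ _ _)
  | mul_add f g h => exact .add_mul _ _ _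
  | add_mul f g h => exact .mul_add _ _ _
  | smul_add c f g => exact .smul_add _ _ _
  | add_smul c d f => simp only [LeavittPre.adj, star_add]; exact .add_smul _ _ _
  | mul_smul c d f => simp only [LeavittPre.adj, star_mul']; exact .mul_smul _ _ _
  | one_smul f => simp only [LeavittPre.adj, star_one]; exact .one_smul _
  | smul_mul c f g => exact .mul_smul_comm _ _ _
  | mul_smul_comm c f g => exact .smul_mul _ _ _
  | vertex_mul_self a => exact .vertex_mul_self _
  | vertex_mul_ne a b hab => exact .vertex_mul_ne _ _ hab.symm
  | source_mul_edge e => exact .ghost_mul_source _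
  | edge_mul_range e => exact .range_mul_ghost _
  | range_mul_ghost e => exact .edge_mul_range _
  | ghost_mul_source e => exact .source_mul_edge _
  | ghost_mul_self e => exact .ghost_mul_self _
  | ghost_mul_ne e f hef => exact .ghost_mul_ne _ _ hef.symm
  | vertex_eq_sum a l ha hl hl' =>
    rw [adj_sumRangeProj]
    exact .vertex_eq_sum _ _ ha hl hl'

end LeavittPre

/-- The Leavitt path algebra `L(G)` over `ℓ`, not unital in general. -/
def Leavitt (ℓ : Type w) [CommRing ℓ] {V : Type u} {E : Type v} (G : DirGraph V E) :
    Type (max u v w) :=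
  Quot (LeavittPre.Rel (ℓ := ℓ) G)

namespace Leavitt

open LeavittPre (Rel)

variable {ℓ : Type w} [CommRing ℓ] {V : Type u} {E : Type v} {G : DirGraph V E}

instance : Zero (Leavitt ℓ G) := ⟨Quot.mk _ .zero⟩

instance : Add (Leavitt ℓ G) :=
  ⟨Quot.map₂ .add (fun f _ _ h => .add_right f h) (fun _ _ g h => .add_left g h)⟩

instance : Neg (Leavitt ℓ G) := ⟨Quot.map .neg fun _ _ h => .neg h⟩

instance : Mul (Leavitt ℓ G) :=
  ⟨Quot.map₂ .mul (fun f _ _ h => .mul_right f h) (fun _ _ g h => .mul_left g h)⟩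

instance : SMul ℓ (Leavitt ℓ G) := ⟨fun c => Quot.map (.smul c) fun _ _ h => .smul c h⟩

instance : AddCommGroup (Leavitt ℓ G) where
  add_assoc := by rintro ⟨f⟩ ⟨g⟩ ⟨h⟩; exact Quot.sound (.add_assoc f g h)
  zero_add := by rintro ⟨f⟩; exact Quot.sound (.zero_add f)
  add_zero := by
    rintro ⟨f⟩
    exact (Quot.sound (.add_comm f .zero)).trans (Quot.sound (.zero_add f))
  add_comm := by rintro ⟨f⟩ ⟨g⟩; exact Quot.sound (.add_comm f g)
  neg_add_cancel := by rintro ⟨f⟩; exact Quot.sound (.neg_add f)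
  nsmul := nsmulRec
  zsmul := zsmulRec

theorem mul_add' (f g h : Leavitt ℓ G) : f * (g + h) = f * g + f * h := by
  obtain ⟨f⟩ := f
  obtain ⟨g⟩ := g
  obtain ⟨h⟩ := h
  exact Quot.sound (.mul_add f g h)

theorem add_mul' (f g h : Leavitt ℓ G) : (f + g) * h = f * h + g * h := by
  obtain ⟨f⟩ := f
  obtain ⟨g⟩ := g
  obtain ⟨h⟩ := h
  exact Quot.sound (.add_mul f g h)

instance : NonUnitalRing (Leavitt ℓ G) where
  left_distrib := mul_add'
  right_distrib := add_mul'
  zero_mul f := by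
    have h := add_mul' 0 0 f
    rwa [add_zero, left_eq_add] at h
  mul_zero f := by
    have h := mul_add' f 0 0
    rwa [add_zero, left_eq_add] at h
  mul_assoc := by rintro ⟨f⟩ ⟨g⟩ ⟨h⟩; exact Quot.sound (.mul_assoc f g h)

instance : Module ℓ (Leavitt ℓ G) :=
  Module.ofMinimalAxioms
    (by rintro c ⟨f⟩ ⟨g⟩; exact Quot.sound (.smul_add c f g))
    (by rintro c d ⟨f⟩; exact Quot.sound (.add_smul c d f))
    (by rintro c d ⟨f⟩; exact Quot.sound (.mul_smul c d f))
    (by rintro ⟨f⟩; exact Quot.sound (.one_smul f))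

instance : IsScalarTower ℓ (Leavitt ℓ G) (Leavitt ℓ G) :=
  ⟨by rintro c ⟨f⟩ ⟨g⟩; exact Quot.sound (.smul_mul c f g)⟩

instance : SMulCommClass ℓ (Leavitt ℓ G) (Leavitt ℓ G) :=
  ⟨by rintro c ⟨f⟩ ⟨g⟩; exact (Quot.sound (.mul_smul_comm c f g)).symm⟩

/-- The standard involution: it is `ℓ`-semilinear, fixes the vertices and exchanges each edge
with its phantom edge. -/
instance [StarRing ℓ] : StarRing (Leavitt ℓ G) where
  star := Quot.map .adj fun _ _ h => h.adj
  star_involutive := by rintro ⟨f⟩; exact congrArg (Quot.mk _) f.adj_adj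
  star_mul := by rintro ⟨f⟩ ⟨g⟩; rfl
  star_add := by rintro ⟨f⟩ ⟨g⟩; rfl

instance [StarRing ℓ] : StarModule ℓ (Leavitt ℓ G) := ⟨by rintro c ⟨f⟩; rfl⟩

variable (ℓ G)

def vertex (a : V) : Leavitt ℓ G := Quot.mk _ (.vertex a)

def edge (e : E) : Leavitt ℓ G := Quot.mk _ (.edge e)

/-- The phantom edge `e*`. -/
def ghost (e : E) : Leavitt ℓ G := Quot.mk _ (.ghost e)

/-- The sum of all vertices, which is the unit of `L(G)` when there are finitely many of them. -/
def unit [Fintype V] : Leavitt ℓ G := ∑ a, vertex ℓ G a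

theorem star_vertex [StarRing ℓ] (a : V) : star (vertex ℓ G a) = vertex ℓ G a := rfl

theorem star_edge [StarRing ℓ] (e : E) : star (edge ℓ G e) = ghost ℓ G e := rfl

theorem star_ghost [StarRing ℓ] (e : E) : star (ghost ℓ G e) = edge ℓ G e := rfl

theorem vertex_mul_self (a : V) : vertex ℓ G a * vertex ℓ G a = vertex ℓ G a :=
  Quot.sound (.vertex_mul_self a)

theorem vertex_mul_ne {a b : V} (h : a ≠ b) : vertex ℓ G a * vertex ℓ G b = 0 :=
  Quot.sound (.vertex_mul_ne a b h)

theorem source_mul_edge (e : E) : vertex ℓ G (G.s e) * edge ℓ G e = edge ℓ G e :=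
  Quot.sound (.source_mul_edge e)

theorem edge_mul_range (e : E) : edge ℓ G e * vertex ℓ G (G.r e) = edge ℓ G e :=
  Quot.sound (.edge_mul_range e)

theorem range_mul_ghost (e : E) : vertex ℓ G (G.r e) * ghost ℓ G e = ghost ℓ G e :=
  Quot.sound (.range_mul_ghost e)

theorem ghost_mul_source (e : E) : ghost ℓ G e * vertex ℓ G (G.s e) = ghost ℓ G e :=
  Quot.sound (.ghost_mul_source e)

theorem ghost_mul_self (e : E) : ghost ℓ G e * edge ℓ G e = vertex ℓ G (G.r e) :=
  Quot.sound (.ghost_mul_self e)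

theorem ghost_mul_ne {e f : E} (h : e ≠ f) : ghost ℓ G e * edge ℓ G f = 0 :=
  Quot.sound (.ghost_mul_ne e f h)

theorem mk_sumRangeProj (l : List E) :
    (Quot.mk _ (LeavittPre.sumRangeProj l) : Leavitt ℓ G) =
      (l.map fun e => edge ℓ G e * ghost ℓ G e).sum := by
  induction l with
  | nil => rfl
  | cons e l ih => rw [List.map_cons, List.sum_cons, ← ih]; rfl

theorem vertex_eq_sum {a : V} (ha : G.IsRegular a) :
    vertex ℓ G a = ∑ e ∈ ha.finite.toFinset, edge ℓ G e * ghost ℓ G e := by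
  have h : vertex ℓ G a = Quot.mk _ (LeavittPre.sumRangeProj ha.finite.toFinset.toList) :=
    Quot.sound (.vertex_eq_sum a _ ha (Finset.nodup_toList _)
      (fun e => by simp [DirGraph.emitted]))
  rw [h, mk_sumRangeProj, Finset.sum_map_toList]

theorem isStarProjection_vertex [StarRing ℓ] (a : V) : IsStarProjection (vertex ℓ G a) :=
  ⟨vertex_mul_self ℓ G a, star_vertex ℓ G a⟩

theorem unit_mul [Fintype V] (f : Leavitt ℓ G) : unit ℓ G * f = f := by
  classical
  have hv (a : V) : unit ℓ G * vertex ℓ G a = vertex ℓ G a := by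
    rw [unit, Finset.sum_mul, Finset.sum_eq_single a
      (fun b _ hb => vertex_mul_ne ℓ G hb) (by simp), vertex_mul_self]
  obtain ⟨f⟩ := f
  induction f with
  | vertex a => exact hv a
  | edge e =>
    change unit ℓ G * edge ℓ G e = edge ℓ G e
    rw [← source_mul_edge, ← mul_assoc, hv]
  | ghost e =>
    change unit ℓ G * ghost ℓ G e = ghost ℓ G e
    rw [← range_mul_ghost, ← mul_assoc, hv]
  | zero => exact mul_zero _
  | add f g hf hg => exact (mul_add _ _ _).trans (congrArg₂ _ hf hg)
  | neg f hf => exact (mul_neg _ _).trans (congrArg _ hf)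
  | mul f g hf hg =>
    let f' : Leavitt ℓ G := Quot.mk _ f
    let g' : Leavitt ℓ G := Quot.mk _ g
    change unit ℓ G * (f' * g') = f' * g'
    rw [← mul_assoc, show unit ℓ G * f' = f' from hf]
  | smul c f hf => exact (mul_smul_comm c _ _).trans (congrArg _ hf)

theorem mul_unit [Fintype V] (f : Leavitt ℓ G) : f * unit ℓ G = f := by
  classical
  have hv (a : V) : vertex ℓ G a * unit ℓ G = vertex ℓ G a := by
    rw [unit, Finset.mul_sum, Finset.sum_eq_single a
      (fun b _ hb => vertex_mul_ne ℓ G hb.symm) (by simp), vertex_mul_self]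
  obtain ⟨f⟩ := f
  induction f with
  | vertex a => exact hv a
  | edge e =>
    change edge ℓ G e * unit ℓ G = edge ℓ G e
    rw [← edge_mul_range, mul_assoc, hv]
  | ghost e =>
    change ghost ℓ G e * unit ℓ G = ghost ℓ G e
    rw [← ghost_mul_source, mul_assoc, hv]
  | zero => exact zero_mul _
  | add f g hf hg => exact (add_mul _ _ _).trans (congrArg₂ _ hf hg)
  | neg f hf => exact (neg_mul _ _).trans (congrArg _ hf)
  | mul f g hf hg =>
    let f' : Leavitt ℓ G := Quot.mk _ f
    let g' : Leavitt ℓ G := Quot.mk _ g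
    change f' * g' * unit ℓ G = f' * g'
    rw [mul_assoc, show g' * unit ℓ G = g' from hg]
  | smul c f hf => exact (smul_mul_assoc c _ _).trans (congrArg _ hf)

end Leavitt

/-! ### Projections, Murray-von Neumann equivalence and `K₀` -/

section Matrices

variable {A : Type x} [NonUnitalRing A] [StarRing A]

/-- Murray-von Neumann equivalence of square matrices of possibly different sizes. For projections
`p` and `q` this is the same as equivalence in a common larger matrix algebra after padding with
zeros, since the partial isometry `x` may be replaced by `q x p`. -/
def MatEquiv {ι κ : Type} [Fintype ι] [Fintype κ] (p : Matrix ι ι A) (q : Matrix κ κ A) : Prop :=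
  ∃ x : Matrix κ ι A, xᴴ * x = p ∧ x * xᴴ = q

variable {ι κ μ ν : Type} [Fintype ι] [Fintype κ] [Fintype μ] [Fintype ν]

theorem MatEquiv.refl {p : Matrix ι ι A} (hp : IsStarProjection p) : MatEquiv p p := by
  have h1 : pᴴ = p := hp.isSelfAdjoint
  have h2 : p * p = p := hp.isIdempotentElem
  exact ⟨p, by rw [h1, h2], by rw [h1, h2]⟩

theorem MatEquiv.symm {p : Matrix ι ι A} {q : Matrix κ κ A} (h : MatEquiv p q) :
    MatEquiv q p := by
  obtain ⟨x, h1, h2⟩ := h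
  exact ⟨xᴴ, by rw [Matrix.conjTranspose_conjTranspose, h2],
    by rw [Matrix.conjTranspose_conjTranspose, h1]⟩

theorem MatEquiv.trans {p : Matrix ι ι A} {q : Matrix κ κ A} {t : Matrix μ μ A}
    (hp : IsStarProjection p) (ht : IsStarProjection t)
    (h : MatEquiv p q) (h' : MatEquiv q t) : MatEquiv p t := by
  obtain ⟨x, h1, h2⟩ := h
  obtain ⟨y, h3, h4⟩ := h'
  have hp' : p * p = p := hp.isIdempotentElem
  have ht' : t * t = t := ht.isIdempotentElem
  refine ⟨y * x, ?_, ?_⟩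
  · calc (y * x)ᴴ * (y * x) = xᴴ * (yᴴ * y) * x := by
          simp only [Matrix.conjTranspose_mul, Matrix.mul_assoc]
      _ = (xᴴ * x) * (xᴴ * x) := by rw [h3, ← h2]; simp only [Matrix.mul_assoc]
      _ = p := by rw [h1, hp']
  · calc (y * x) * (y * x)ᴴ = y * (x * xᴴ) * yᴴ := by
          simp only [Matrix.conjTranspose_mul, Matrix.mul_assoc]
      _ = (y * yᴴ) * (y * yᴴ) := by rw [h2, ← h3]; simp only [Matrix.mul_assoc]
      _ = t := by rw [h4, ht']

theorem IsStarProjection.submatrix_equiv {p : Matrix ι ι A} (hp : IsStarProjection p)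
    (e : κ ≃ ι) : IsStarProjection (p.submatrix e e) := by
  have h1 : pᴴ = p := hp.isSelfAdjoint
  have h2 : p * p = p := hp.isIdempotentElem
  refine ⟨?_, ?_⟩
  · change p.submatrix e e * p.submatrix e e = _
    rw [Matrix.submatrix_mul_equiv, h2]
  · change (p.submatrix e e)ᴴ = _
    rw [Matrix.conjTranspose_submatrix, h1]

theorem MatEquiv.submatrix {p : Matrix ι ι A} (hp : IsStarProjection p) (e : κ ≃ ι) :
    MatEquiv p (p.submatrix e e) := by
  have h1 : pᴴ = p := hp.isSelfAdjoint
  have h2 : p * p = p := hp.isIdempotentElem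
  refine ⟨p.submatrix e id, ?_, ?_⟩
  · rw [Matrix.conjTranspose_submatrix, h1, Matrix.submatrix_mul_equiv, h2, Matrix.submatrix_id_id]
  · have := Matrix.submatrix_mul_equiv p p e (Equiv.refl ι) e
    rw [h2] at this
    rw [Matrix.conjTranspose_submatrix, h1]
    exact this

/-- The orthogonal sum of two matrices. -/
def blockSum (p : Matrix ι ι A) (q : Matrix κ κ A) : Matrix (ι ⊕ κ) (ι ⊕ κ) A :=
  Matrix.fromBlocks p 0 0 q

theorem IsStarProjection.blockSum {p : Matrix ι ι A} {q : Matrix κ κ A}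
    (hp : IsStarProjection p) (hq : IsStarProjection q) : IsStarProjection (blockSum p q) := by
  have h1 : pᴴ = p := hp.isSelfAdjoint
  have h2 : p * p = p := hp.isIdempotentElem
  have h3 : qᴴ = q := hq.isSelfAdjoint
  have h4 : q * q = q := hq.isIdempotentElem
  refine ⟨?_, ?_⟩
  · change Matrix.fromBlocks p 0 0 q * Matrix.fromBlocks p 0 0 q = _
    simp [Matrix.fromBlocks_multiply, h2, h4, _root_.blockSum]
  · change (Matrix.fromBlocks p 0 0 q)ᴴ = _
    simp [Matrix.fromBlocks_conjTranspose, h1, h3, _root_.blockSum]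

theorem MatEquiv.blockSum {p : Matrix ι ι A} {q : Matrix κ κ A} {p' : Matrix μ μ A}
    {q' : Matrix ν ν A} (h : MatEquiv p p') (h' : MatEquiv q q') :
    MatEquiv (blockSum p q) (blockSum p' q') := by
  obtain ⟨x, h1, h2⟩ := h
  obtain ⟨y, h3, h4⟩ := h'
  refine ⟨Matrix.fromBlocks x 0 0 y, ?_, ?_⟩
  · simp [Matrix.fromBlocks_conjTranspose, Matrix.fromBlocks_multiply, h1, h3, _root_.blockSum]
  · simp [Matrix.fromBlocks_conjTranspose, Matrix.fromBlocks_multiply, h2, h4, _root_.blockSum]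

end Matrices

section KTheory

variable (A : Type x) [NonUnitalRing A] [StarRing A]

/-- Projections in the matrix algebras `Mₙ(A)`, for all `n`. -/
structure MatProj where
  size : ℕ
  mat : Matrix (Fin size) (Fin size) A
  isStarProjection : IsStarProjection mat

/-- Murray-von Neumann equivalence of projection matrices of all sizes. -/
def MatProj.setoid : Setoid (MatProj A) where
  r p q := MatEquiv p.mat q.mat
  iseqv :=
    { refl := fun p => .refl p.isStarProjection
      symm := fun h => h.symm
      trans := fun {p _ t} h h' => .trans p.isStarProjection t.isStarProjection h h' }

/-- The monoid of Murray-von Neumann equivalence classes of projections in matrices over `A`. -/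
def VMonoid : Type x := Quotient (MatProj.setoid A)

variable {A}

/-- The orthogonal sum of two projection matrices. -/
def MatProj.sum (p q : MatProj A) : MatProj A where
  size := p.size + q.size
  mat := (blockSum p.mat q.mat).submatrix finSumFinEquiv.symm finSumFinEquiv.symm
  isStarProjection := (p.isStarProjection.blockSum q.isStarProjection).submatrix_equiv _

theorem MatProj.sum_equiv (p q : MatProj A) : MatEquiv (p.sum q).mat (blockSum p.mat q.mat) :=
  (MatEquiv.submatrix (p.isStarProjection.blockSum q.isStarProjection) _).symm

/-- The projection of size zero. -/
def MatProj.empty : MatProj A where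
  size := 0
  mat := 0
  isStarProjection := ⟨Subsingleton.elim _ _, Subsingleton.elim _ _⟩

namespace VMonoid

def mk (p : MatProj A) : VMonoid A := Quotient.mk (MatProj.setoid A) p

theorem mk_eq {p q : MatProj A} (h : MatEquiv p.mat q.mat) : mk p = mk q :=
  Quotient.sound (s := MatProj.setoid A) h

theorem mk_eq_iff {p q : MatProj A} : mk p = mk q ↔ MatEquiv p.mat q.mat :=
  ⟨fun h => Quotient.exact (s := MatProj.setoid A) h, mk_eq⟩

instance : Zero (VMonoid A) := ⟨mk .empty⟩

instance : Add (VMonoid A) :=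
  ⟨Quotient.map₂ MatProj.sum fun p p' h q q' h' =>
    MatEquiv.trans (p.sum q).isStarProjection (p'.sum q').isStarProjection (p.sum_equiv q)
      (MatEquiv.trans (p.isStarProjection.blockSum q.isStarProjection)
        (p'.sum q').isStarProjection (MatEquiv.blockSum h h') (p'.sum_equiv q').symm)⟩

theorem mk_add_mk (p q : MatProj A) : mk p + mk q = mk (p.sum q) := rfl

theorem mk_add_mk_eq {p q t : MatProj A} (h : MatEquiv (blockSum p.mat q.mat) t.mat) :
    mk p + mk q = mk t :=
  mk_eq (.trans (p.sum q).isStarProjection t.isStarProjection (p.sum_equiv q) h)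

instance : AddCommMonoid (VMonoid A) where
  nsmul := nsmulRec
  add_comm := by
    rintro ⟨p⟩ ⟨q⟩
    have hq := q.isStarProjection.blockSum p.isStarProjection
    refine mk_add_mk_eq (p := p) (q := q) (t := q.sum p)
      (.trans (p.isStarProjection.blockSum q.isStarProjection) (q.sum p).isStarProjection ?_
        (q.sum_equiv p).symm)
    have h := MatEquiv.submatrix hq (Equiv.sumComm (Fin p.size) (Fin q.size))
    convert! h.symm using 1
    ext (i | i) (j | j) <;> rfl
  zero_add := by
    rintro ⟨p⟩
    refine mk_add_mk_eq (p := MatProj.empty) (q := p) (t := p) ?_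
    have h := MatEquiv.submatrix p.isStarProjection (Equiv.emptySum (Fin 0) (Fin p.size))
    convert! h.symm using 1
    ext (i | i) (j | j)
    · exact i.elim0
    · exact i.elim0
    · exact j.elim0
    · rfl
  add_zero := by
    rintro ⟨p⟩
    refine mk_add_mk_eq (p := p) (q := MatProj.empty) (t := p) ?_
    have h := MatEquiv.submatrix p.isStarProjection (Equiv.sumEmpty (Fin p.size) (Fin 0))
    convert! h.symm using 1
    ext (i | i) (j | j)
    · rfl
    · exact j.elim0
    · exact i.elim0
    · exact i.elim0
  add_assoc := by
    rintro ⟨p⟩ ⟨q⟩ ⟨t⟩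
    have hp := p.isStarProjection
    have hq := q.isStarProjection
    have ht := t.isStarProjection
    have e1 : MatEquiv ((p.sum q).sum t).mat (blockSum (blockSum p.mat q.mat) t.mat) :=
      .trans ((p.sum q).sum t).isStarProjection ((hp.blockSum hq).blockSum ht)
        ((p.sum q).sum_equiv t) (.blockSum (p.sum_equiv q) (.refl ht))
    have e2 : MatEquiv (p.sum (q.sum t)).mat (blockSum p.mat (blockSum q.mat t.mat)) :=
      .trans (p.sum (q.sum t)).isStarProjection (hp.blockSum (hq.blockSum ht))
        (p.sum_equiv (q.sum t)) (.blockSum (.refl hp) (q.sum_equiv t))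
    have e3 : MatEquiv (blockSum (blockSum p.mat q.mat) t.mat)
        (blockSum p.mat (blockSum q.mat t.mat)) := by
      have h := MatEquiv.submatrix (hp.blockSum (hq.blockSum ht))
        (Equiv.sumAssoc (Fin p.size) (Fin q.size) (Fin t.size))
      convert! h.symm using 1
      ext ((i | i) | i) ((j | j) | j) <;> rfl
    exact mk_eq (p := (p.sum q).sum t) (q := p.sum (q.sum t))
      (.trans ((p.sum q).sum t).isStarProjection (p.sum (q.sum t)).isStarProjection e1
        (.trans ((hp.blockSum hq).blockSum ht) (p.sum (q.sum t)).isStarProjection e3 e2.symm))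

/-- The class of a projection of `A`, regarded as a matrix of size one. -/
def ofProj (p : A) (hp : IsStarProjection p) : VMonoid A :=
  mk
    { size := 1
      mat := Matrix.of fun _ _ => p
      isStarProjection := by
        have h1 : star p = p := hp.isSelfAdjoint
        have h2 : p * p = p := hp.isIdempotentElem
        refine ⟨?_, ?_⟩
        · ext i j
          simp [Matrix.mul_apply, h2]
        · ext i j
          simp [Matrix.star_apply, h1] }

theorem ofProj_eq {p q : A} (hp : IsStarProjection p) (hq : IsStarProjection q) (y : A)
    (h1 : star y * y = p) (h2 : y * star y = q) : ofProj p hp = ofProj q hq := by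
  refine mk_eq ⟨Matrix.of fun _ _ => y, ?_, ?_⟩
  · ext i j
    simp [Matrix.mul_apply, h1]
  · ext i j
    simp [Matrix.mul_apply, h2]

theorem ofProj_add {p q : A} (hp : IsStarProjection p) (hq : IsStarProjection q)
    (hpq : p * q = 0) (h : IsStarProjection (p + q)) :
    ofProj p hp + ofProj q hq = ofProj (p + q) h := by
  have h1 : star p = p := hp.isSelfAdjoint
  have h2 : p * p = p := hp.isIdempotentElem
  have h3 : star q = q := hq.isSelfAdjoint
  have h4 : q * q = q := hq.isIdempotentElem
  have hqp : q * p = 0 := by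
    have := congrArg star hpq
    rwa [star_mul, h1, h3, star_zero] at this
  refine mk_add_mk_eq (MatEquiv.symm
    ⟨Matrix.of (Sum.elim (fun _ _ => p) (fun _ _ => q)), ?_, ?_⟩)
  · ext i j
    simp [Matrix.mul_apply, h1, h2, h3, h4]
  · ext (i | i) (j | j) <;>
      simp [Matrix.mul_apply, blockSum, h1, h2, h3, h4, hpq, hqp, Subsingleton.elim i j]

theorem ofProj_zero : ofProj (0 : A) ⟨mul_zero _, star_zero _⟩ = 0 := by
  refine mk_eq ⟨0, ?_, ?_⟩
  · ext i j
    simp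
  · ext i j
    exact i.elim0

section Map

variable {ℓ : Type w} [Monoid ℓ] {B : Type v} [NonUnitalRing B] [StarRing B]
  [DistribMulAction ℓ A] [DistribMulAction ℓ B]

theorem map_mul_matrix (φ : A →⋆ₙₐ[ℓ] B) {ι κ μ : Type} [Fintype κ]
    (a : Matrix ι κ A) (b : Matrix κ μ A) : (a * b).map φ = a.map φ * b.map φ := by
  ext i j
  simp [Matrix.mul_apply, map_sum, map_mul]

theorem map_conjTranspose (φ : A →⋆ₙₐ[ℓ] B) {ι κ : Type} (a : Matrix ι κ A) :
    aᴴ.map φ = (a.map φ)ᴴ := by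
  ext i j
  simp [map_star]

/-- A `*`-homomorphism, not necessarily unital, applied to the entries of a projection. -/
def _root_.MatProj.map (φ : A →⋆ₙₐ[ℓ] B) (p : MatProj A) : MatProj B where
  size := p.size
  mat := p.mat.map φ
  isStarProjection := by
    have h1 : p.matᴴ = p.mat := p.isStarProjection.isSelfAdjoint
    have h2 : p.mat * p.mat = p.mat := p.isStarProjection.isIdempotentElem
    refine ⟨?_, ?_⟩
    · change p.mat.map φ * p.mat.map φ = _
      rw [← map_mul_matrix, h2]
    · change (p.mat.map φ)ᴴ = _
      rw [← map_conjTranspose, h1]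

/-- The monoid homomorphism induced by a `*`-homomorphism. -/
def map (φ : A →⋆ₙₐ[ℓ] B) : VMonoid A →+ VMonoid B where
  toFun := Quotient.map (MatProj.map φ) fun p q => by
    rintro ⟨y, h1, h2⟩
    refine ⟨y.map φ, ?_, ?_⟩
    · change (y.map φ)ᴴ * y.map φ = p.mat.map φ
      rw [← map_conjTranspose, ← map_mul_matrix, h1]
    · change y.map φ * (y.map φ)ᴴ = q.mat.map φ
      rw [← map_conjTranspose, ← map_mul_matrix, h2]
  map_zero' := mk_eq (p := MatProj.map φ MatProj.empty) (q := MatProj.empty)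
    ⟨0, Subsingleton.elim (α := Matrix (Fin 0) (Fin 0) B) _ _,
      Subsingleton.elim (α := Matrix (Fin 0) (Fin 0) B) _ _⟩
  map_add' := by
    rintro ⟨p⟩ ⟨q⟩
    refine congrArg mk (?_ : MatProj.map φ (p.sum q) = (p.map φ).sum (q.map φ))
    have h : (blockSum p.mat q.mat).map φ = blockSum (p.mat.map φ) (q.mat.map φ) := by
      ext (i | i) (j | j) <;> simp [blockSum]
    simp only [MatProj.map, MatProj.sum, ← h]
    rfl

end Map

end VMonoid

variable (A) in
/-- The group completion of the monoid of equivalence classes of projections in matrices over `A`.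
For `A` without unit this is the right notion when `A` has enough projections as local units, as
is the case for every Leavitt path algebra. -/
abbrev KZero : Type x := Algebra.GrothendieckAddGroup (VMonoid A)

namespace KZero

/-- The class in `K₀` of a projection of `A`. -/
def ofProj (p : A) (hp : IsStarProjection p) : KZero A :=
  Algebra.GrothendieckAddGroup.of (VMonoid.ofProj p hp)

/-- The homomorphism induced in `K₀` by a `*`-homomorphism. -/
def map {ℓ : Type w} [Monoid ℓ] {B : Type v} [NonUnitalRing B] [StarRing B]
    [DistribMulAction ℓ A] [DistribMulAction ℓ B] (φ : A →⋆ₙₐ[ℓ] B) : KZero A →+ KZero B :=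
  Algebra.GrothendieckAddGroup.lift (Algebra.GrothendieckAddGroup.of.comp (VMonoid.map φ))

theorem ofProj_add {p q : A} (hp : IsStarProjection p) (hq : IsStarProjection q)
    (hpq : p * q = 0) (h : IsStarProjection (p + q)) :
    ofProj p hp + ofProj q hq = ofProj (p + q) h := by
  rw [ofProj, ofProj, ofProj, ← map_add, VMonoid.ofProj_add hp hq hpq h]

theorem ofProj_sum {ι : Type*} (f : ι → A) (hf : ∀ i, IsStarProjection (f i))
    (hf' : ∀ i j, i ≠ j → f i * f j = 0) (t : Finset ι) :
    ∃ h : IsStarProjection (∑ i ∈ t, f i), ∑ i ∈ t, ofProj (f i) (hf i) = ofProj _ h := by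
  classical
  induction t using Finset.induction_on with
  | empty =>
    refine ⟨by simp, ?_⟩
    simp only [Finset.sum_empty, ofProj, VMonoid.ofProj_zero, map_zero]
  | insert i t hi ih =>
    obtain ⟨h, ih⟩ := ih
    have hz : f i * ∑ j ∈ t, f j = 0 := by
      rw [Finset.mul_sum]
      exact Finset.sum_eq_zero fun j hj => hf' i j fun hij => hi (hij ▸ hj)
    have hs : IsStarProjection (f i + ∑ j ∈ t, f j) := (hf i).add h hz
    refine ⟨by rw [Finset.sum_insert hi]; exact hs, ?_⟩
    simp only [Finset.sum_insert hi]
    rw [ih, ofProj_add (hf i) h hz hs]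

end KZero

end KTheory

/-! ### The canonical map from the Bowen-Franks group -/

namespace Leavitt

variable (ℓ : Type w) [CommRing ℓ] [StarRing ℓ] {V : Type u} {E : Type v} (G : DirGraph V E)

/-- The class of a vertex in the `K₀` of the Leavitt path algebra. -/
def vertexClass (a : V) : KZero (Leavitt ℓ G) :=
  KZero.ofProj (vertex ℓ G a) (isStarProjection_vertex ℓ G a)

theorem isStarProjection_edge_mul_ghost (e : E) :
    IsStarProjection (edge ℓ G e * ghost ℓ G e) := by
  refine ⟨?_, ?_⟩
  · change edge ℓ G e * ghost ℓ G e * (edge ℓ G e * ghost ℓ G e) = _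
    rw [mul_assoc, ← mul_assoc (ghost ℓ G e), ghost_mul_self, range_mul_ghost]
  · change star (edge ℓ G e * ghost ℓ G e) = _
    rw [star_mul, star_edge, star_ghost]

theorem vertexClass_eq_sum {a : V} (ha : G.IsRegular a) :
    vertexClass ℓ G a = ∑ e ∈ ha.finite.toFinset, vertexClass ℓ G (G.r e) := by
  obtain ⟨h, hs⟩ := KZero.ofProj_sum (fun e => edge ℓ G e * ghost ℓ G e)
    (isStarProjection_edge_mul_ghost ℓ G)
    (fun e f hef => by
      rw [mul_assoc, ← mul_assoc (ghost ℓ G e), ghost_mul_ne ℓ G hef, zero_mul, mul_zero])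
    ha.finite.toFinset
  have h1 (e : E) : vertexClass ℓ G (G.r e) =
      KZero.ofProj (edge ℓ G e * ghost ℓ G e) (isStarProjection_edge_mul_ghost ℓ G e) :=
    congrArg Algebra.GrothendieckAddGroup.of
      (VMonoid.ofProj_eq _ _ (edge ℓ G e) (ghost_mul_self ℓ G e) rfl)
  simp only [h1]
  rw [hs]
  simp only [vertexClass, vertex_eq_sum ℓ G ha]

/-- The canonical homomorphism from the Bowen-Franks group of `G` to the `K₀` of its Leavitt path
algebra, sending the class of a vertex to the class of that vertex. -/
def can : G.BowenFranks →+ KZero (Leavitt ℓ G) :=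
  (Submodule.liftQ (LinearMap.range G.oneSubIncidenceTranspose)
    (Finsupp.linearCombination ℤ (vertexClass ℓ G)) (by
      rintro _ ⟨y, rfl⟩
      rw [LinearMap.mem_ker]
      induction y using Finsupp.induction_linear with
      | zero => simp
      | add f g hf hg => rw [map_add, map_add, hf, hg, add_zero]
      | single a n =>
        rw [DirGraph.oneSubIncidenceTranspose, Finsupp.linearCombination_single, map_smul,
          DirGraph.incidence_column, map_sub, map_sum]
        simp only [Finsupp.linearCombination_single, one_smul]
        rw [vertexClass_eq_sum ℓ G a.2, sub_self, smul_zero])).toAddMonoidHom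

theorem can_bfClass (a : V) : can ℓ G (G.bfClass a) = vertexClass ℓ G a := by
  simp [can, DirGraph.bfClass]

end Leavitt

/-! ### Very full projections and homomorphisms -/

section VeryFull

variable {R : Type x} [Ring R] [StarRing R]

variable (R) in
/-- A unital `*`-algebra is strictly properly infinite if it contains two orthogonal isometries. -/
def IsStrictlyProperlyInfinite : Prop :=
  ∃ s t : R, star s * s = 1 ∧ star t * t = 1 ∧ star s * t = 0

/-- Murray-von Neumann equivalence of elements. -/
def MvNEquiv (p q : R) : Prop := ∃ y : R, star y * y = p ∧ y * star y = q

/-- A projection is very full if it dominates a projection equivalent to `1`. -/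
def IsVeryFullProjection (p : R) : Prop :=
  IsStarProjection p ∧ ∃ q : R, IsStarProjection q ∧ q = p * q ∧ q = q * p ∧ MvNEquiv q 1

/-- A homomorphism from a Leavitt path algebra is very full if it maps all the `e e*`, for `e` an
edge, and all the singular vertices to very full projections. -/
def IsVeryFullHom {ℓ : Type w} [CommRing ℓ] [StarRing ℓ] [Algebra ℓ R] {V : Type u} {E : Type v}
    {G : DirGraph V E} (φ : Leavitt ℓ G →⋆ₙₐ[ℓ] R) : Prop :=
  (∀ e : E, IsVeryFullProjection (φ (Leavitt.edge ℓ G e * star (Leavitt.edge ℓ G e)))) ∧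
    ∀ a : V, G.IsSingular a → IsVeryFullProjection (φ (Leavitt.vertex ℓ G a))

end VeryFull

end

/-!
In a strictly properly infinite algebra `R`, the class of `1` is a largest element for the algebraic
preorder on the monoid of classes of projections. The classes above it, which are those of the very
full projections, therefore form a group, and this group maps isomorphically onto `K₀(R)`: every
class in `K₀(R)` is that of a very full projection, and two very full projections with the same
class are equivalent. As `R` contains infinitely many isometries with orthogonal ranges, there is
moreover room below any very full projection for countably many orthogonal very full projections
with prescribed classes in `K₀(R)`.

Choose in this way orthogonal very full projections `P v` with classes `ξ [v]`, and below each `P v`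
orthogonal very full projections `Q e` with classes `ξ [r e]`, for the edges `e` emitted by `v`. If
`v` is regular, the relation `[v] = ∑ [r e]` allows one to choose the `Q e` with sum exactly `P v`.
Since `P (r e)` and `Q e` have the same class, a partial isometry carries the former to the latter;
these partial isometries are the images of the edges.
-/

section Grothendieck

open Algebra

variable {M : Type*} [AddCommMonoid M] {u : M}

/-- An element of a commutative monoid which is largest for the algebraic preorder, in which
`x ≤ y` means that `y = x + z` for some `z`. The class of `1` is such an element of the monoid of
classes of projections of a strictly properly infinite algebra. -/
def IsAlgebraicTop (u : M) : Prop := ∀ x, ∃ y, x + y = u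

namespace IsAlgebraicTop

theorem injOn_grothendieck_of (hu : IsAlgebraicTop u) :
    Set.InjOn (GrothendieckAddGroup.of (M := M)) (Set.range (u + ·)) := by
  rintro _ ⟨x, rfl⟩ _ ⟨y, rfl⟩ h
  obtain ⟨⟨d, _⟩, hd⟩ := (AddLocalization.addMonoidOf (⊤ : AddSubmonoid M)).eq_iff_exists.1 h
  replace hd : d + (u + x) = d + (u + y) := hd
  obtain ⟨d', hd'⟩ := hu d
  obtain ⟨c, hc⟩ := hu (u + u)
  have absorb (x : M) : u + x = c + (u + (u + x)) := by
    calc u + x = u + u + c + x := by rw [hc]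
      _ = c + (u + (u + x)) := by abel
  have cancel_u : u + (u + x) = u + (u + y) := by
    calc u + (u + x) = d' + (d + (u + x)) := by rw [← add_assoc d', add_comm d', hd']
      _ = d' + (d + (u + y)) := by rw [hd]
      _ = u + (u + y) := by rw [← add_assoc d', add_comm d', hd']
  change u + x = u + y
  rw [absorb x, cancel_u, ← absorb y]

theorem surjOn_grothendieck_of (hu : IsAlgebraicTop u) :
    Set.SurjOn (GrothendieckAddGroup.of (M := M)) (Set.range (u + ·)) Set.univ := by
  intro z _
  obtain ⟨⟨a, b, _⟩, hab⟩ := (AddLocalization.addMonoidOf (⊤ : AddSubmonoid M)).surj z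
  replace hab : z + GrothendieckAddGroup.of b = GrothendieckAddGroup.of a := hab
  obtain ⟨b', hb⟩ := hu b
  obtain ⟨c, hc⟩ := hu (u + u)
  have of_c : GrothendieckAddGroup.of u + GrothendieckAddGroup.of c = 0 := by
    have h := congrArg GrothendieckAddGroup.of hc
    rwa [map_add, map_add, add_assoc, add_eq_left] at h
  have of_b : GrothendieckAddGroup.of b + GrothendieckAddGroup.of b' =
      GrothendieckAddGroup.of u := by
    rw [← map_add, hb]
  refine ⟨u + (c + (a + b' + c)), ⟨_, rfl⟩, ?_⟩
  calc GrothendieckAddGroup.of (u + (c + (a + b' + c)))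
      = (GrothendieckAddGroup.of u + GrothendieckAddGroup.of c) + z +
          (GrothendieckAddGroup.of b + GrothendieckAddGroup.of b' +
            GrothendieckAddGroup.of c) := by
        simp only [map_add, ← hab]
        abel
    _ = z := by rw [of_b, of_c, zero_add, add_zero]

end IsAlgebraicTop

end Grothendieck

section Isometries

theorem mul_eq_swap_of_isSelfAdjoint {R : Type*} [Mul R] [StarMul R] {a b c : R}
    (ha : IsSelfAdjoint a) (hb : IsSelfAdjoint b) (hc : IsSelfAdjoint c) (h : a * b = c) :
    b * a = c := by
  rw [← hc.star_eq, ← h, star_mul, ha.star_eq, hb.star_eq]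

theorem isStarProjection_mul_mul_star {R : Type*} [Monoid R] [StarMul R] {p y : R}
    (hp : IsStarProjection p) (hy : star y * y = 1) : IsStarProjection (y * p * star y) where
  isIdempotentElem := by
    calc y * p * star y * (y * p * star y) = y * (p * (star y * y) * p) * star y := by
          simp only [mul_assoc]
      _ = y * p * star y := by rw [hy, mul_one, hp.isIdempotentElem.eq]
  isSelfAdjoint := hp.isSelfAdjoint.conjugate y

theorem isStarProjection_mul_mul_conjTranspose {A ι κ : Type*} [Semiring A] [StarRing A]
    [Fintype ι] [DecidableEq ι] [Fintype κ] {p : Matrix ι ι A} {S : Matrix κ ι A}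
    (hp : IsStarProjection p) (hS : Sᴴ * S = 1) : IsStarProjection (S * p * Sᴴ) where
  isIdempotentElem := by
    change S * p * Sᴴ * (S * p * Sᴴ) = _
    calc S * p * Sᴴ * (S * p * Sᴴ) = S * (p * (Sᴴ * S) * p) * Sᴴ := by
          simp only [Matrix.mul_assoc]
      _ = S * p * Sᴴ := by rw [hS, Matrix.mul_one, hp.isIdempotentElem.eq]
  isSelfAdjoint := by
    have hp' : pᴴ = p := hp.isSelfAdjoint
    change (S * p * Sᴴ)ᴴ = _
    simp only [Matrix.conjTranspose_mul, Matrix.conjTranspose_conjTranspose, hp', Matrix.mul_assoc]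

theorem MatEquiv.mul_mul_conjTranspose {A : Type*} {ι κ : Type} [Ring A] [StarRing A]
    [Fintype ι] [DecidableEq ι] [Fintype κ] {p : Matrix ι ι A} {S : Matrix κ ι A}
    (hp : IsStarProjection p) (hS : Sᴴ * S = 1) : MatEquiv p (S * p * Sᴴ) := by
  have hp' : pᴴ = p := hp.isSelfAdjoint
  refine ⟨S * p, ?_, ?_⟩
  · calc (S * p)ᴴ * (S * p) = p * (Sᴴ * S) * p := by
          rw [Matrix.conjTranspose_mul, hp']
          simp only [Matrix.mul_assoc]
      _ = p := by rw [hS, Matrix.mul_one, hp.isIdempotentElem.eq]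
  · calc S * p * (S * p)ᴴ = S * (p * p) * Sᴴ := by
          rw [Matrix.conjTranspose_mul, hp']
          simp only [Matrix.mul_assoc]
      _ = S * p * Sᴴ := by rw [hp.isIdempotentElem.eq]

theorem IsStrictlyProperlyInfinite.exists_orthogonal_isometries {R : Type*} [Ring R] [StarRing R]
    (hR : IsStrictlyProperlyInfinite R) :
    ∃ y : ℕ → R, (∀ n, star (y n) * y n = 1) ∧ Pairwise fun m n => star (y m) * y n = 0 := by
  obtain ⟨s, t, hs, ht, hst⟩ := hR
  have hts : star t * s = 0 := by simpa using congrArg star hst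
  have hpow (n : ℕ) : star (s ^ n) * s ^ n = 1 := by
    rw [star_pow, pow_mul_pow_eq_one n hs]
  have hlt (m k : ℕ) : star (s ^ m * t) * (s ^ (m + k + 1) * t) = 0 := by
    calc star (s ^ m * t) * (s ^ (m + k + 1) * t)
        = star t * (star (s ^ m) * s ^ m) * s * s ^ k * t := by
          rw [star_mul, add_assoc, pow_add, pow_succ']
          simp only [mul_assoc]
      _ = 0 := by rw [hpow, mul_one, hts, zero_mul, zero_mul]
  refine ⟨fun n => s ^ n * t, fun n => ?_, fun m n hmn => ?_⟩
  · rw [star_mul, mul_assoc, ← mul_assoc _ _ t, hpow, one_mul, ht]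
  · rcases lt_or_gt_of_ne hmn with h | h <;> obtain ⟨k, rfl⟩ := Nat.exists_eq_add_of_lt h
    · exact hlt m k
    · simpa using congrArg star (hlt n k)

end Isometries

section ProjectionClasses

namespace VMonoid

section NonUnital

variable {A : Type*} [NonUnitalRing A] [StarRing A]

theorem exists_partialIsometry_of_ofProj_eq {p q : A} {hp : IsStarProjection p}
    {hq : IsStarProjection q} (h : ofProj p hp = ofProj q hq) :
    ∃ y : A, star y * y = p ∧ y * star y = q ∧ y * p = y ∧ q * y = y := by
  obtain ⟨x, hx, hx'⟩ := mk_eq_iff.1 h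
  obtain ⟨y, h1, h2⟩ : ∃ y : A, star y * y = p ∧ y * star y = q :=
    ⟨x 0 0, by simpa [Matrix.mul_apply] using congrFun (congrFun hx 0) 0,
      by simpa [Matrix.mul_apply] using congrFun (congrFun hx' 0) 0⟩
  have hpp : p * p = p := hp.isIdempotentElem
  have hqy : q * y = y * p := by rw [← h1, ← h2, mul_assoc]
  -- `y` itself need not satisfy `y * p = y`, since `a* a = 0` does not force `a = 0`.
  refine ⟨y * p, ?_, ?_, by rw [mul_assoc, hpp], by rw [← mul_assoc, hqy, mul_assoc, hpp]⟩
  · rw [star_mul, hp.isSelfAdjoint.star_eq, mul_assoc, ← mul_assoc (star y), h1, hpp, hpp]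
  · rw [star_mul, hp.isSelfAdjoint.star_eq, mul_assoc, ← mul_assoc p, hpp, ← mul_assoc, ← hqy,
      mul_assoc, h2, hq.isIdempotentElem.eq]

theorem exists_ofProj_eq_mk {Q : Matrix (Fin 1) (Fin 1) A} (hQ : IsStarProjection Q) :
    ∃ (p : A) (hp : IsStarProjection p), ofProj p hp = mk ⟨1, Q, hQ⟩ := by
  have hp : IsStarProjection (Q 0 0) :=
    { isIdempotentElem := by
        change Q 0 0 * Q 0 0 = Q 0 0
        simpa [Matrix.mul_apply] using congrFun (congrFun hQ.isIdempotentElem.eq 0) 0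
      isSelfAdjoint := congrFun (congrFun hQ.isSelfAdjoint.star_eq 0) 0 }
  refine ⟨Q 0 0, hp, congrArg mk ?_⟩
  congr 1
  ext i j
  rw [Subsingleton.elim i 0, Subsingleton.elim j 0, Matrix.of_apply]

end NonUnital

variable {R : Type*} [Ring R] [StarRing R]

theorem ofProj_mul_mul_star {p y : R} (hp : IsStarProjection p) (hy : star y * y = 1) :
    ofProj (y * p * star y) (isStarProjection_mul_mul_star hp hy) = ofProj p hp := by
  refine (ofProj_eq _ _ (y * p) ?_ ?_).symm
  · rw [star_mul, hp.isSelfAdjoint.star_eq, mul_assoc, ← mul_assoc _ y, hy, one_mul,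
      hp.isIdempotentElem.eq]
  · rw [star_mul, hp.isSelfAdjoint.star_eq, mul_assoc, ← mul_assoc p, hp.isIdempotentElem.eq,
      mul_assoc]

variable (R) in
/-- The class of the unit of a unital algebra, regarded as a projection. -/
def unitClass : VMonoid R := ofProj 1 (.one R)

theorem ofProj_add_ofProj_one_sub {p : R} (hp : IsStarProjection p) :
    ofProj p hp + ofProj (1 - p) hp.one_sub = unitClass R := by
  rw [ofProj_add hp hp.one_sub hp.mul_one_sub_self (by simp)]
  simp only [add_sub_cancel, unitClass]

end VMonoid

namespace KZero

theorem map_ofProj {A B ℓ : Type*} [NonUnitalRing A] [StarRing A] [NonUnitalRing B] [StarRing B]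
    [Monoid ℓ] [DistribMulAction ℓ A] [DistribMulAction ℓ B] (φ : A →⋆ₙₐ[ℓ] B) {p : A}
    (hp : IsStarProjection p) : map φ (ofProj p hp) = ofProj (φ p) (hp.map φ) :=
  DFunLike.congr_fun (Algebra.GrothendieckAddGroup.lift.symm_apply_apply
    (Algebra.GrothendieckAddGroup.of.comp (VMonoid.map φ))) (VMonoid.ofProj p hp)

end KZero

namespace IsStrictlyProperlyInfinite

variable {R : Type*} [Ring R] [StarRing R]

theorem exists_vMonoid_ofProj_eq (hR : IsStrictlyProperlyInfinite R) (c : VMonoid R) :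
    ∃ (p : R) (hp : IsStarProjection p), VMonoid.ofProj p hp = c := by
  obtain ⟨y, h_one, h_zero⟩ := hR.exists_orthogonal_isometries
  obtain ⟨P⟩ := c
  let S : Matrix (Fin 1) (Fin P.size) R := Matrix.of fun _ j => y j
  have hS : Sᴴ * S = 1 := by
    ext i j
    rcases eq_or_ne i j with rfl | hij
    · simp [S, Matrix.mul_apply, h_one]
    · simp [S, Matrix.mul_apply, hij, h_zero (Fin.val_injective.ne hij)]
  obtain ⟨p, hp, hpS⟩ := VMonoid.exists_ofProj_eq_mk
    (isStarProjection_mul_mul_conjTranspose P.isStarProjection hS)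
  exact ⟨p, hp, hpS.trans
    (VMonoid.mk_eq (MatEquiv.mul_mul_conjTranspose P.isStarProjection hS)).symm⟩

theorem isAlgebraicTop_unitClass (hR : IsStrictlyProperlyInfinite R) :
    IsAlgebraicTop (VMonoid.unitClass R) := by
  intro c
  obtain ⟨q, hq, rfl⟩ := hR.exists_vMonoid_ofProj_eq c
  exact ⟨_, VMonoid.ofProj_add_ofProj_one_sub hq⟩

end IsStrictlyProperlyInfinite

end ProjectionClasses

section VeryFullProjections

variable {R : Type*} [Ring R] [StarRing R] {p q y : R}

theorem isVeryFullProjection_iff_exists_isometry :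
    IsVeryFullProjection p ↔ IsStarProjection p ∧ ∃ y : R, star y * y = 1 ∧ p * y = y := by
  refine and_congr_right fun hp => ⟨?_, ?_⟩
  · rintro ⟨_, -, hpq, -, y, rfl, hy⟩
    refine ⟨star y, by rwa [star_star], ?_⟩
    calc p * star y = p * (star y * y) * star y := by rw [mul_assoc, mul_assoc, hy, mul_one]
      _ = star y := by rw [← hpq, mul_assoc, hy, mul_one]
  · rintro ⟨y, hy, hpy⟩
    have hq : IsStarProjection (y * star y) := by
      simpa only [mul_one] using isStarProjection_mul_mul_star (.one R) hy
    have hpq : p * (y * star y) = y * star y := by rw [← mul_assoc, hpy]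
    exact ⟨_, hq, hpq.symm, (mul_eq_swap_of_isSelfAdjoint hp.isSelfAdjoint hq.isSelfAdjoint
      hq.isSelfAdjoint hpq).symm, star y, by rw [star_star], by rw [star_star, hy]⟩

namespace IsVeryFullProjection

theorem one : IsVeryFullProjection (1 : R) :=
  isVeryFullProjection_iff_exists_isometry.2 ⟨.one R, 1, by simp, by simp⟩

theorem mul_mul_star (hp : IsVeryFullProjection p) (hy : star y * y = 1) :
    IsVeryFullProjection (y * p * star y) := by
  obtain ⟨hp, x, hx, hpx⟩ := isVeryFullProjection_iff_exists_isometry.1 hp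
  refine isVeryFullProjection_iff_exists_isometry.2
    ⟨isStarProjection_mul_mul_star hp hy, y * x, ?_, ?_⟩
  · rw [star_mul, mul_assoc, ← mul_assoc _ y, hy, one_mul, hx]
  · rw [mul_assoc, ← mul_assoc _ y, hy, one_mul, mul_assoc, hpx]

theorem of_mul_eq_right (hp : IsVeryFullProjection p) (hq : IsStarProjection q)
    (hqp : q * p = p) : IsVeryFullProjection q := by
  obtain ⟨-, y, hy, hpy⟩ := isVeryFullProjection_iff_exists_isometry.1 hp
  exact isVeryFullProjection_iff_exists_isometry.2
    ⟨hq, y, hy, by rw [← hpy, ← mul_assoc, hqp]⟩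

theorem vMonoid_ofProj_mem_range (hp : IsVeryFullProjection p) :
    VMonoid.ofProj p hp.1 ∈ Set.range (VMonoid.unitClass R + ·) := by
  obtain ⟨hp', y, hy, hpy⟩ := isVeryFullProjection_iff_exists_isometry.1 hp
  have hq := isStarProjection_mul_mul_star (.one R) hy
  have hpq : p * (y * 1 * star y) = y * 1 * star y := by rw [mul_one, ← mul_assoc, hpy]
  have hqp := mul_eq_swap_of_isSelfAdjoint hp'.isSelfAdjoint hq.isSelfAdjoint
    hq.isSelfAdjoint hpq
  have hsub := hq.sub_of_mul_eq_left hp' hqp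
  refine ⟨VMonoid.ofProj _ hsub, ?_⟩
  change VMonoid.ofProj 1 _ + _ = _
  rw [← VMonoid.ofProj_mul_mul_star (.one R) hy, VMonoid.ofProj_add hq hsub
    (by rw [mul_sub, hqp, hq.isIdempotentElem.eq, sub_self]) (by rwa [add_sub_cancel])]
  simp only [add_sub_cancel]

end IsVeryFullProjection

namespace IsStrictlyProperlyInfinite

theorem exists_isVeryFullProjection_vMonoid (hR : IsStrictlyProperlyInfinite R) (c : VMonoid R) :
    ∃ (p : R) (hp : IsVeryFullProjection p),
      VMonoid.ofProj p hp.1 = VMonoid.unitClass R + c := by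
  obtain ⟨d, hd, rfl⟩ := hR.exists_vMonoid_ofProj_eq c
  obtain ⟨s, t, hs, ht, hst⟩ := hR
  have hp := IsVeryFullProjection.one.mul_mul_star hs
  have hq := isStarProjection_mul_mul_star hd ht
  have hpq : s * 1 * star s * (t * d * star t) = 0 := by
    calc s * 1 * star s * (t * d * star t) = s * (star s * t) * d * star t := by
          simp only [mul_one, mul_assoc]
      _ = 0 := by rw [hst, mul_zero, zero_mul, zero_mul]
  have hqp := mul_eq_swap_of_isSelfAdjoint hp.1.isSelfAdjoint hq.isSelfAdjoint (.zero R) hpq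
  refine ⟨_, hp.of_mul_eq_right (hp.1.add hq hpq) ?_, ?_⟩
  · rw [add_mul, hqp, add_zero, hp.1.isIdempotentElem.eq]
  · rw [← VMonoid.ofProj_add hp.1 hq hpq, VMonoid.ofProj_mul_mul_star (.one R) hs,
      VMonoid.ofProj_mul_mul_star hd ht, VMonoid.unitClass]

theorem exists_isVeryFullProjection_kZero (hR : IsStrictlyProperlyInfinite R) (z : KZero R) :
    ∃ (p : R) (hp : IsVeryFullProjection p), KZero.ofProj p hp.1 = z := by
  obtain ⟨_, ⟨c, rfl⟩, rfl⟩ :=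
    hR.isAlgebraicTop_unitClass.surjOn_grothendieck_of (Set.mem_univ z)
  obtain ⟨p, hp, hpc⟩ := hR.exists_isVeryFullProjection_vMonoid c
  exact ⟨p, hp, congrArg Algebra.GrothendieckAddGroup.of hpc⟩

theorem exists_partialIsometry_of_kZero_eq (hR : IsStrictlyProperlyInfinite R)
    (hp : IsVeryFullProjection p) (hq : IsVeryFullProjection q)
    (h : KZero.ofProj p hp.1 = KZero.ofProj q hq.1) :
    ∃ y : R, star y * y = p ∧ y * star y = q ∧ y * p = y ∧ q * y = y :=
  VMonoid.exists_partialIsometry_of_ofProj_eq (hR.isAlgebraicTop_unitClass.injOn_grothendieck_of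
    hp.vMonoid_ofProj_mem_range hq.vMonoid_ofProj_mem_range h)

end IsStrictlyProperlyInfinite

end VeryFullProjections

section VeryFullFamilies

variable {R ι : Type*} [Ring R] [StarRing R] {p : R} {z : ι → KZero R} {q : ι → R}

/-- Pairwise orthogonal very full projections `q i` below a projection `p`, with prescribed classes
`z i` in `K₀`. The images of the vertices of a graph, and those of the `e e*`, form such
families. -/
structure IsVeryFullFamily (p : R) (z : ι → KZero R) (q : ι → R) : Prop where
  isVeryFullProjection (i : ι) : IsVeryFullProjection (q i)
  mul_left (i : ι) : p * q i = q i
  pairwise_mul_eq_zero : Pairwise fun i j => q i * q j = 0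
  kZero_eq (i : ι) : KZero.ofProj (q i) (isVeryFullProjection i).1 = z i

namespace IsVeryFullFamily

theorem isStarProjection (hq : IsVeryFullFamily p z q) (i : ι) : IsStarProjection (q i) :=
  (hq.isVeryFullProjection i).1

theorem mul_right (hq : IsVeryFullFamily p z q) (hp : IsStarProjection p) (i : ι) :
    q i * p = q i :=
  mul_eq_swap_of_isSelfAdjoint hp.isSelfAdjoint (hq.isStarProjection i).isSelfAdjoint
    (hq.isStarProjection i).isSelfAdjoint (hq.mul_left i)

theorem mul_sum [Fintype ι] (hq : IsVeryFullFamily p z q) (i : ι) : q i * ∑ j, q j = q i := by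
  rw [Finset.mul_sum, Finset.sum_eq_single i
    (fun j _ hj => hq.pairwise_mul_eq_zero hj.symm) (by simp),
    (hq.isStarProjection i).isIdempotentElem.eq]

theorem kZero_sum [Fintype ι] (hq : IsVeryFullFamily p z q) :
    ∃ h : IsStarProjection (∑ i, q i), KZero.ofProj _ h = ∑ i, z i := by
  obtain ⟨h, hsum⟩ := KZero.ofProj_sum q hq.isStarProjection
    (fun _ _ hij => hq.pairwise_mul_eq_zero hij) Finset.univ
  exact ⟨h, by simp only [← hsum, hq.kZero_eq]⟩

theorem update_add [DecidableEq ι] (hq : IsVeryFullFamily p z q) (o : ι) {d : R}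
    (hd : IsStarProjection d) (hpd : p * d = d) (hqd : ∀ i, q i * d = 0)
    (hd0 : KZero.ofProj d hd = 0) :
    IsVeryFullFamily p z (Function.update q o (q o + d)) := by
  have hdq (i : ι) : d * q i = 0 := mul_eq_swap_of_isSelfAdjoint
    (hq.isStarProjection i).isSelfAdjoint hd.isSelfAdjoint (.zero R) (hqd i)
  have ho : IsVeryFullProjection (q o + d) := by
    refine (hq.isVeryFullProjection o).of_mul_eq_right
      ((hq.isStarProjection o).add hd (hqd o)) ?_
    rw [add_mul, hdq, add_zero, (hq.isStarProjection o).isIdempotentElem.eq]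
  refine ⟨fun i => ?_, fun i => ?_, fun i j hij => ?_, fun i => ?_⟩
  · rcases eq_or_ne i o with rfl | hi
    · simpa using ho
    · simpa [hi] using hq.isVeryFullProjection i
  · rcases eq_or_ne i o with rfl | hi
    · simp [mul_add, hq.mul_left, hpd]
    · simp [hi, hq.mul_left]
  · rcases eq_or_ne i o with rfl | hi
    · simp [hij.symm, add_mul, hdq, hq.pairwise_mul_eq_zero hij]
    · rcases eq_or_ne j o with rfl | hj
      · simp [hi, mul_add, hqd, hq.pairwise_mul_eq_zero hij]
      · simp [hi, hj, hq.pairwise_mul_eq_zero hij]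
  · rcases eq_or_ne i o with rfl | hi
    · simp [← KZero.ofProj_add (hq.isStarProjection i) hd (hqd i) ho.1, hd0, hq.kZero_eq]
    · simp [hi, hq.kZero_eq]

theorem of_fiberwise {κ : Type*} {s : κ → ι} {w : κ → KZero R} {t : κ → R}
    (hq : IsVeryFullFamily p z q)
    (ht : ∀ i, IsVeryFullFamily (q i) (fun k : {k // s k = i} => w k) (fun k => t k)) :
    IsVeryFullFamily p w t := by
  have hqt (k : κ) : q (s k) * t k = t k := (ht (s k)).mul_left ⟨k, rfl⟩
  have htq (k : κ) : t k * q (s k) = t k :=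
    (ht (s k)).mul_right (hq.isStarProjection _) ⟨k, rfl⟩
  refine ⟨fun k => (ht (s k)).isVeryFullProjection ⟨k, rfl⟩, fun k => ?_, fun k l hkl => ?_,
    fun k => (ht (s k)).kZero_eq ⟨k, rfl⟩⟩
  · rw [← hqt k, ← mul_assoc, hq.mul_left]
  · by_cases h : s k = s l
    · exact (ht (s l)).pairwise_mul_eq_zero (i := ⟨k, h⟩) (j := ⟨l, rfl⟩)
        (Subtype.coe_ne_coe.1 hkl)
    · change t k * t l = 0
      rw [← htq k, ← hqt l, mul_assoc, ← mul_assoc (q _), hq.pairwise_mul_eq_zero h, zero_mul,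
        mul_zero]

end IsVeryFullFamily

namespace IsVeryFullProjection

theorem exists_isVeryFullFamily [Countable ι] (hR : IsStrictlyProperlyInfinite R)
    (hp : IsVeryFullProjection p) (z : ι → KZero R) : ∃ q : ι → R, IsVeryFullFamily p z q := by
  obtain ⟨y, h_one, h_zero⟩ := hR.exists_orthogonal_isometries
  obtain ⟨-, x, hx, hpx⟩ := isVeryFullProjection_iff_exists_isometry.1 hp
  obtain ⟨k, hk⟩ := exists_injective_nat ι
  choose r hr hrz using fun i => hR.exists_isVeryFullProjection_kZero (z i)
  have hxy (i j : ι) : star (x * y (k i)) * (x * y (k j)) = star (y (k i)) * y (k j) := by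
    rw [star_mul, mul_assoc, ← mul_assoc _ x, hx, one_mul]
  have hw (i : ι) : star (x * y (k i)) * (x * y (k i)) = 1 := by rw [hxy, h_one]
  refine ⟨fun i => x * y (k i) * r i * star (x * y (k i)),
    fun i => (hr i).mul_mul_star (hw i), fun i => ?_, fun i j hij => ?_, fun i => ?_⟩
  · simp only [← mul_assoc, hpx]
  · calc x * y (k i) * r i * star (x * y (k i)) * (x * y (k j) * r j * star (x * y (k j)))
        = x * y (k i) * r i * (star (x * y (k i)) * (x * y (k j))) *
            (r j * star (x * y (k j))) := by simp only [mul_assoc]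
      _ = 0 := by rw [hxy, h_zero (hk.ne hij), mul_zero, zero_mul]
  · rw [← hrz i]
    exact congrArg _ (VMonoid.ofProj_mul_mul_star (hr i).1 (hw i))

theorem exists_isVeryFullFamily_sum_eq [Fintype ι] [Nonempty ι]
    (hR : IsStrictlyProperlyInfinite R) (hp : IsVeryFullProjection p) {z : ι → KZero R}
    (hz : KZero.ofProj p hp.1 = ∑ i, z i) :
    ∃ q : ι → R, IsVeryFullFamily p z q ∧ ∑ i, q i = p := by
  classical
  obtain ⟨q, hq⟩ := hp.exists_isVeryFullFamily hR z
  obtain ⟨hr, hr_class⟩ := hq.kZero_sum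
  set r := ∑ i, q i
  -- The gap `p - r` has class `[p] - ∑ z i = 0`, so it may be added to any one of the `q i`.
  have hpr : p * r = r := by
    rw [Finset.mul_sum]
    exact Finset.sum_congr rfl fun i _ => hq.mul_left i
  have hgap : IsStarProjection (p - r) := hr.sub_of_mul_eq_right hp.1 hpr
  have hgap_mul : (p - r) * r = 0 := by rw [sub_mul, hpr, hr.isIdempotentElem.eq, sub_self]
  have hgap_class : KZero.ofProj (p - r) hgap = 0 := by
    have h := KZero.ofProj_add hgap hr hgap_mul (by simpa using hp.1)
    simp only [sub_add_cancel, hz] at h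
    rwa [hr_class, add_eq_right] at h
  let o : ι := Classical.arbitrary ι
  refine ⟨_, hq.update_add o hgap ?_ (fun i => ?_) hgap_class, ?_⟩
  · rw [mul_sub, hp.1.isIdempotentElem.eq, hpr]
  · rw [mul_sub, hq.mul_right hp.1, hq.mul_sum, sub_self]
  · rw [Finset.sum_update_of_mem (Finset.mem_univ o), add_right_comm,
      ← Finset.sum_eq_add_sum_sdiff_singleton_of_mem (Finset.mem_univ o), add_sub_cancel]

end IsVeryFullProjection

end VeryFullFamilies

namespace DirGraph

variable {V E : Type*} (G : DirGraph V E)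

theorem bowenFranks_addHom_ext {B : Type*} [AddMonoid B] {f g : G.BowenFranks →+ B}
    (h : ∀ a, f (G.bfClass a) = g (G.bfClass a)) : f = g := by
  let π : (V →₀ ℤ) →+ G.BowenFranks := (Submodule.mkQ _).toAddMonoidHom
  have hπ : Function.Surjective π := Submodule.mkQ_surjective _
  exact (AddMonoidHom.cancel_right hπ).1
    (Finsupp.addHom_ext' fun a => AddMonoidHom.ext_int (h a))

theorem bfClass_eq_sum {a : V} (ha : G.IsRegular a) :
    G.bfClass a = ∑ e ∈ ha.finite.toFinset, G.bfClass (G.r e) := by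
  have hsum : ∑ e ∈ ha.finite.toFinset, G.bfClass (G.r e) = Submodule.Quotient.mk
      (∑ e ∈ ha.finite.toFinset, Finsupp.single (G.r e) (1 : ℤ)) :=
    (map_sum (Submodule.mkQ (LinearMap.range G.oneSubIncidenceTranspose)) _ _).symm
  rw [hsum, bfClass, Submodule.Quotient.eq]
  refine ⟨Finsupp.single ⟨a, ha⟩ 1, ?_⟩
  rw [oneSubIncidenceTranspose, Finsupp.linearCombination_single, one_smul, incidence_column]

end DirGraph

section UniversalProperty

variable {V E R : Type*} [NonUnitalRing R] [StarRing R]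

/-- Elements of a `*`-algebra satisfying the relations of the Leavitt path algebra of `G`: the
values at the vertices and at the edges of a `*`-homomorphism. -/
structure IsLeavittFamily (G : DirGraph V E) (P : V → R) (X : E → R) : Prop where
  isStarProjection (a : V) : IsStarProjection (P a)
  pairwise_mul_eq_zero : Pairwise fun a b => P a * P b = 0
  source_mul (e : E) : P (G.s e) * X e = X e
  mul_range (e : E) : X e * P (G.r e) = X e
  star_mul_self (e : E) : star (X e) * X e = P (G.r e)
  pairwise_star_mul_eq_zero : Pairwise fun e f => star (X e) * X f = 0
  vertex_eq_sum {a : V} (ha : G.IsRegular a) :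
    P a = ∑ e ∈ ha.finite.toFinset, X e * star (X e)

variable {ℓ : Type*} [CommRing ℓ] [Module ℓ R]

/-- The value of a formal expression, given the values of the vertices and of the edges. -/
def LeavittPre.eval (P : V → R) (X : E → R) : LeavittPre ℓ V E → R
  | vertex a => P a
  | edge e => X e
  | ghost e => star (X e)
  | zero => 0
  | add f g => eval P X f + eval P X g
  | neg f => -eval P X f
  | mul f g => eval P X f * eval P X g
  | smul c f => c • eval P X f

theorem LeavittPre.eval_sumRangeProj (P : V → R) (X : E → R) (l : List E) :
    (sumRangeProj l : LeavittPre ℓ V E).eval P X = (l.map fun e => X e * star (X e)).sum := by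
  induction l with
  | nil => rfl
  | cons e l ih => rw [List.map_cons, List.sum_cons, ← ih]; rfl

namespace IsLeavittFamily

variable {G : DirGraph V E} {P : V → R} {X : E → R}

theorem star_mul_source (h : IsLeavittFamily G P X) (e : E) :
    star (X e) * P (G.s e) = star (X e) := by
  rw [← (h.isStarProjection _).isSelfAdjoint.star_eq, ← star_mul, h.source_mul]

theorem range_mul_star (h : IsLeavittFamily G P X) (e : E) :
    P (G.r e) * star (X e) = star (X e) := by
  rw [← (h.isStarProjection _).isSelfAdjoint.star_eq, ← star_mul, h.mul_range]

theorem vertex_eq_list_sum (h : IsLeavittFamily G P X) {a : V} (ha : G.IsRegular a) {l : List E}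
    (hl : l.Nodup) (hmem : ∀ e, e ∈ l ↔ G.s e = a) :
    P a = (l.map fun e => X e * star (X e)).sum := by
  classical
  have hfin : ha.finite.toFinset = l.toFinset := by
    ext e
    simp [DirGraph.emitted, hmem]
  rw [h.vertex_eq_sum ha, hfin, List.sum_toFinset _ hl]

theorem eval_eq [IsScalarTower ℓ R R] [SMulCommClass ℓ R R] (h : IsLeavittFamily G P X)
    {f g : LeavittPre ℓ V E} (hfg : LeavittPre.Rel G f g) : f.eval P X = g.eval P X := by
  induction hfg with
  | symm _ ih => exact ih.symm
  | add_left _ _ ih | add_right _ _ ih | neg _ ih | mul_left _ _ ih | mul_right _ _ ih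
  | smul _ _ ih => simp only [LeavittPre.eval, ih]
  | add_assoc => exact add_assoc _ _ _
  | add_comm => exact add_comm _ _
  | zero_add => exact zero_add _
  | neg_add => exact neg_add_cancel _
  | mul_assoc => exact mul_assoc _ _ _
  | mul_add => exact mul_add _ _ _
  | add_mul => exact add_mul _ _ _
  | smul_add => exact smul_add _ _ _
  | add_smul => exact add_smul _ _ _
  | mul_smul => exact mul_smul _ _ _
  | one_smul => exact one_smul _ _
  | smul_mul => exact smul_mul_assoc _ _ _
  | mul_smul_comm => exact mul_smul_comm _ _ _
  | vertex_mul_self a => exact (h.isStarProjection a).isIdempotentElem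
  | vertex_mul_ne _ _ hab => exact h.pairwise_mul_eq_zero hab
  | source_mul_edge e => exact h.source_mul e
  | edge_mul_range e => exact h.mul_range e
  | range_mul_ghost e => exact h.range_mul_star e
  | ghost_mul_source e => exact h.star_mul_source e
  | ghost_mul_self e => exact h.star_mul_self e
  | ghost_mul_ne _ _ hef => exact h.pairwise_star_mul_eq_zero hef
  | vertex_eq_sum _ _ ha hl hmem =>
    exact (h.vertex_eq_list_sum ha hl hmem).trans (LeavittPre.eval_sumRangeProj P X _).symm

theorem eval_adj [StarRing ℓ] [StarModule ℓ R] (h : IsLeavittFamily G P X)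
    (f : LeavittPre ℓ V E) : f.adj.eval P X = star (f.eval P X) := by
  induction f with
  | vertex a => exact (h.isStarProjection a).isSelfAdjoint.star_eq.symm
  | edge e => rfl
  | ghost e => exact (star_star _).symm
  | zero => exact (star_zero _).symm
  | add f g hf hg => simp only [LeavittPre.adj, LeavittPre.eval, hf, hg, star_add]
  | neg f hf => simp only [LeavittPre.adj, LeavittPre.eval, hf, star_neg]
  | mul f g hf hg => simp only [LeavittPre.adj, LeavittPre.eval, hf, hg, star_mul]
  | smul c f hf => simp only [LeavittPre.adj, LeavittPre.eval, hf, star_smul]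

end IsLeavittFamily

namespace Leavitt

variable [IsScalarTower ℓ R R] [SMulCommClass ℓ R R] [StarRing ℓ] [StarModule ℓ R]
  {G : DirGraph V E} {P : V → R} {X : E → R}

variable (ℓ) in
/-- The universal property of the Leavitt path algebra: the `*`-homomorphism with prescribed values
at the vertices and at the edges. -/
def lift (h : IsLeavittFamily G P X) : Leavitt ℓ G →⋆ₙₐ[ℓ] R where
  toFun := Quot.lift (LeavittPre.eval P X) fun _ _ hfg => h.eval_eq hfg
  map_smul' := by rintro c ⟨f⟩; rfl
  map_zero' := rfl
  map_add' := by rintro ⟨f⟩ ⟨g⟩; rfl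
  map_mul' := by rintro ⟨f⟩ ⟨g⟩; rfl
  map_star' := by rintro ⟨f⟩; exact h.eval_adj f

theorem lift_vertex (h : IsLeavittFamily G P X) (a : V) : lift ℓ h (vertex ℓ G a) = P a := rfl

theorem lift_edge (h : IsLeavittFamily G P X) (e : E) : lift ℓ h (edge ℓ G e) = X e := rfl

end Leavitt

end UniversalProperty

section VeryFullHomomorphisms

variable {R V E : Type*} [Ring R] [StarRing R] {G : DirGraph V E} {p : R} {z : V → KZero R}
  {P : V → R}

theorem IsVeryFullProjection.exists_emitted_family (hR : IsStrictlyProperlyInfinite R)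
    (hp : IsVeryFullProjection p) {a : V} [Countable (G.emitted a)] (w : E → KZero R)
    (hw : ∀ ha : G.IsRegular a, KZero.ofProj p hp.1 = ∑ e ∈ ha.finite.toFinset, w e) :
    ∃ q : G.emitted a → R, IsVeryFullFamily p (fun e : G.emitted a => w e) q ∧
      (G.IsRegular a → ∑ᶠ e, q e = p) := by
  by_cases ha : G.IsRegular a
  · have := ha.finite.fintype
    have := ha.nonempty.to_subtype
    obtain ⟨q, hq, hsum⟩ := hp.exists_isVeryFullFamily_sum_eq hR
      (z := fun e : G.emitted a => w e) (by
        rw [hw ha]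
        exact Finset.sum_subtype _ (by simp) _)
    exact ⟨q, hq, fun _ => by rw [finsum_eq_sum_of_fintype, hsum]⟩
  · obtain ⟨q, hq⟩ := hp.exists_isVeryFullFamily hR fun e : G.emitted a => w e
    exact ⟨q, hq, fun h => absurd h ha⟩

theorem IsVeryFullFamily.exists_edge_family [∀ a, Countable (G.emitted a)]
    (hR : IsStrictlyProperlyInfinite R) (hP : IsVeryFullFamily p z P)
    (hz : ∀ a (ha : G.IsRegular a), z a = ∑ e ∈ ha.finite.toFinset, z (G.r e)) :
    ∃ Q : E → R, IsVeryFullFamily p (fun e => z (G.r e)) Q ∧ (∀ e, P (G.s e) * Q e = Q e) ∧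
      ∀ a (ha : G.IsRegular a), P a = ∑ e ∈ ha.finite.toFinset, Q e := by
  choose q hq hsum using fun a => (hP.isVeryFullProjection a).exists_emitted_family hR
    (fun e => z (G.r e)) (fun ha => (hP.kZero_eq a).trans (hz a ha))
  let Q (e : E) : R := q (G.s e) ⟨e, rfl⟩
  have hQ (a : V) : q a = fun e : G.emitted a => Q e := by
    ext ⟨e, rfl⟩
    rfl
  simp only [hQ] at hq hsum
  refine ⟨Q, hP.of_fiberwise hq, fun e => (hq (G.s e)).mul_left ⟨e, rfl⟩, fun a ha => ?_⟩
  rw [← hsum a ha, finsum_set_coe_eq_finsum_mem, finsum_mem_eq_finite_toFinset_sum]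

theorem IsVeryFullFamily.exists_isLeavittFamily [∀ a, Countable (G.emitted a)]
    (hR : IsStrictlyProperlyInfinite R) (hP : IsVeryFullFamily p z P)
    (hz : ∀ a (ha : G.IsRegular a), z a = ∑ e ∈ ha.finite.toFinset, z (G.r e)) :
    ∃ X : E → R, IsLeavittFamily G P X ∧ ∀ e, IsVeryFullProjection (X e * star (X e)) := by
  obtain ⟨Q, hQ, hPQ, hsum⟩ := hP.exists_edge_family hR hz
  choose X hX_star_mul hX_mul_star hX_right hX_left using fun e =>
    hR.exists_partialIsometry_of_kZero_eq (hP.isVeryFullProjection (G.r e))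
      (hQ.isVeryFullProjection e) ((hP.kZero_eq _).trans (hQ.kZero_eq e).symm)
  refine ⟨X, ?_, fun e => hX_mul_star e ▸ hQ.isVeryFullProjection e⟩
  exact
    { isStarProjection := hP.isStarProjection
      pairwise_mul_eq_zero := hP.pairwise_mul_eq_zero
      source_mul := fun e => by rw [← hX_left e, ← mul_assoc, hPQ]
      mul_range := hX_right
      star_mul_self := hX_star_mul
      pairwise_star_mul_eq_zero := fun e f hef => by
        change star (X e) * X f = 0
        rw [← hX_left e, ← hX_left f, star_mul, (hQ.isStarProjection e).isSelfAdjoint.star_eq,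
          mul_assoc, ← mul_assoc (Q e), hQ.pairwise_mul_eq_zero hef, zero_mul, mul_zero]
      vertex_eq_sum := fun {a} ha => by simp only [hX_mul_star, hsum a ha] }

theorem Leavitt.exists_isVeryFullHom {ℓ : Type*} [CommRing ℓ] [StarRing ℓ] [Algebra ℓ R]
    [StarModule ℓ R] [∀ a, Countable (G.emitted a)] (hR : IsStrictlyProperlyInfinite R)
    (ξ : G.BowenFranks →+ KZero R) (hP : IsVeryFullFamily p (fun a => ξ (G.bfClass a)) P) :
    ∃ φ : Leavitt ℓ G →⋆ₙₐ[ℓ] R, IsVeryFullHom φ ∧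
      (KZero.map φ).comp (can ℓ G) = ξ ∧ ∀ a, φ (vertex ℓ G a) = P a := by
  obtain ⟨X, hX, hX_veryFull⟩ := hP.exists_isLeavittFamily hR fun a ha => by
    rw [G.bfClass_eq_sum ha, map_sum]
  refine ⟨lift ℓ hX, ⟨fun e => ?_, fun a _ => hP.isVeryFullProjection a⟩,
    G.bowenFranks_addHom_ext fun a => ?_, lift_vertex hX⟩
  · rw [map_mul, map_star, lift_edge]
    exact hX_veryFull e
  · rw [AddMonoidHom.comp_apply, can_bfClass, vertexClass, KZero.map_ofProj, ← hP.kZero_eq]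
    simp only [lift_vertex]

end VeryFullHomomorphisms

theorem mainTheorem10 {ℓ : Type*} [CommRing ℓ] [StarRing ℓ]
    {R : Type*} [Ring R] [StarRing R] [Algebra ℓ R] [StarModule ℓ R]
    (hR : IsStrictlyProperlyInfinite R)
    {V E : Type*} [Countable V] [Countable E] (G : DirGraph V E)
    (ξ : G.BowenFranks →+ KZero R) :
    (∃ φ : Leavitt ℓ G →⋆ₙₐ[ℓ] R,
      IsVeryFullHom φ ∧ (KZero.map φ).comp (Leavitt.can ℓ G) = ξ) ∧
    (∀ [Fintype V] [Nonempty V] (p : R) (hp : IsVeryFullProjection p),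
      ξ G.bfOne = KZero.ofProj p hp.1 →
      ∃ φ : Leavitt ℓ G →⋆ₙₐ[ℓ] R,
        IsVeryFullHom φ ∧ (KZero.map φ).comp (Leavitt.can ℓ G) = ξ ∧
          φ (Leavitt.unit ℓ G) = p) := by
  refine ⟨?_, fun {_ _} p hp hξp => ?_⟩
  · obtain ⟨P, hP⟩ := IsVeryFullProjection.one.exists_isVeryFullFamily hR
      fun a => ξ (G.bfClass a)
    obtain ⟨φ, hφ, hφξ, -⟩ := Leavitt.exists_isVeryFullHom (ℓ := ℓ) hR ξ hP
    exact ⟨φ, hφ, hφξ⟩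
  · obtain ⟨P, hP, hsum⟩ := hp.exists_isVeryFullFamily_sum_eq hR
      (z := fun a => ξ (G.bfClass a)) (by rw [← hξp, DirGraph.bfOne, map_sum])
    obtain ⟨φ, hφ, hφξ, hφP⟩ := Leavitt.exists_isVeryFullHom (ℓ := ℓ) hR ξ hP
    refine ⟨φ, hφ, hφξ, ?_⟩
    rw [Leavitt.unit, map_sum, ← hsum]
    exact Finset.sum_congr rfl fun a _ => hφP a
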